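/- Let $n\ge 0$ and let $|\psi\rangle\in(\mathbb C^2)^{\otimes n}$ be a unit vector (a pure state of $n$ qubits). Let $|\psi^*\rangle$ denote its entrywise complex conjugate in the computational basis, and let $\log$ be the logarithm to base $2$. Let $\tilde G_n$ be the set of Pauli strings $\sigma_1\otimes\cdots\otimes\sigma_n$ with $\sigma_i\in\{I,X,Y,Z\}$, and let $G_n=\{cP : c\in\{\pm1,\pm i\},\ P\in\tilde G_n\}$ be the Pauli group. A pure stabilizer state is a unit vector $|\phi\rangle$ for which there are mutually commuting $S_1,\dots,S_n\in G_n$ with $S_j|\phi\rangle=|\phi\rangle$ and $S_j^2=I$ for all $j$, and such that no $S_j$ is, up to a phase, a product of some (possibly empty) subset of the other $S_l$. Define - the chiral log-distance $C=-\log\max_{U_1,\dots,U_n}|\langle\psi^*|U_1\otimes\cdots\otimes U_n|\psi\rangle|^2$, the maximum being over all one-qubit unitaries $U_1,\dots,U_n$; - its restriction to Pauli strings, $C_P=-\log\max_{P\in G_n}|\langle\psi^*|P|\psi\rangle|^2$; - the stabilizer nullity $\nu=n-k$, where $2^k$ is the number of $P\in\tilde G_n$ with $\langle\psi|P|\psi\rangle=\pm1$;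 - the stabilizer fidelity $F=\max_\phi|\langle\phi|\psi\rangle|^2$, the maximum being over all pure stabilizer states $|\phi\rangle$ of $n$ qubits. Proposition. These quantities are well defined (the three maxima are attained and positive, and the number of $P\in\tilde G_n$ with $\langle\psi|P|\psi\rangle=\pm1$ is $2^k$ for an integer $0\le k\le n$), and 1. $C\le C_P\le\nu$; 2. $C\le C_P\le-2\log F$. If $|\psi\rangle$ is a pure stabilizer state, then all these inequalities are equalities; in fact $C=C_P=\nu=-2\log F=0$. -/

import Mathlib

noncomputable section

namespace ChiralityMagic

/-- The Hilbert space `(ℂ²)^{⊗ n}` of `n` qubits, with the computational basis labelled by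
bit strings `Fin n → Fin 2`. -/
abbrev QubitSpace (n : ℕ) : Type := EuclideanSpace ℂ (Fin n → Fin 2)

/-- Operators on `n` qubits, as matrices in the computational basis. -/
abbrev QubitOp (n : ℕ) : Type := Matrix (Fin n → Fin 2) (Fin n → Fin 2) ℂ

/-- The tensor product `U₁ ⊗ ⋯ ⊗ Uₙ` of one-qubit operators. -/
def tensorOp {n : ℕ} (U : Fin n → Matrix (Fin 2) (Fin 2) ℂ) : QubitOp n :=
  Matrix.of fun s t => ∏ i, U i (s i) (t i)

/-- The matrix element `⟨φ|A|ψ⟩`. -/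
def braket {n : ℕ} (φ : QubitSpace n) (A : QubitOp n) (ψ : QubitSpace n) : ℂ :=
  inner ℂ φ (WithLp.toLp 2 (Matrix.mulVec A ψ.ofLp))

/-- The complex conjugate `ψ*` in the computational basis. -/
def conjState {n : ℕ} (ψ : QubitSpace n) : QubitSpace n :=
  WithLp.toLp 2 fun s => star (ψ s)

/-- The one-qubit Pauli operators `I, X, Y, Z`. -/
def pauli : Fin 4 → Matrix (Fin 2) (Fin 2) ℂ :=
  ![1, !![0, 1; 1, 0], !![0, -Complex.I; Complex.I, 0], !![1, 0; 0, -1]]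

/-- The Pauli strings on `n` qubits, with overall phase fixed to `+1`. -/
def pauliStrings (n : ℕ) : Set (QubitOp n) :=
  {P | ∃ p : Fin n → Fin 4, P = tensorOp fun i => pauli (p i)}

/-- The Pauli group on `n` qubits: Pauli strings with any of the phases `±1, ±i`. -/
def pauliGroup (n : ℕ) : Set (QubitOp n) :=
  {P | ∃ c : ℂ, (c = 1 ∨ c = -1 ∨ c = Complex.I ∨ c = -Complex.I) ∧
    ∃ Q ∈ pauliStrings n, P = c • Q}

/-- The product of the `S l` with `l ∈ T`, taken in increasing order of `l`. -/
def subsetProd {n : ℕ} (S : Fin n → QubitOp n) (T : Finset (Fin n)) : QubitOp n :=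
  (List.ofFn fun l => if l ∈ T then S l else 1).prod

/-- `S₁, …, Sₙ` are mutually commuting elements of the Pauli group that square to the identity and
are independent: no `S j` is, up to a phase, a product of some (possibly empty) subset of the
others. -/
structure IsStabilizerGenerators {n : ℕ} (S : Fin n → QubitOp n) : Prop where
  mem_pauliGroup : ∀ j, S j ∈ pauliGroup n
  commute : ∀ i j, S i * S j = S j * S i
  sq_eq_one : ∀ j, S j * S j = 1
  independent : ∀ (j : Fin n) (T : Finset (Fin n)), j ∉ T →
    ∀ c : ℂ, S j ≠ c • subsetProd S T

/-- A pure stabilizer state of `n` qubits: a unit vector fixed by `n` stabilizer generators. -/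
def IsStabilizerState {n : ℕ} (φ : QubitSpace n) : Prop :=
  ‖φ‖ = 1 ∧ ∃ S : Fin n → QubitOp n, IsStabilizerGenerators S ∧
    ∀ j, Matrix.mulVec (S j) φ.ofLp = φ.ofLp

/-- The values `|⟨ψ*| U₁ ⊗ ⋯ ⊗ Uₙ |ψ⟩|²`, over all one-qubit unitaries `U₁, …, Uₙ`. -/
def localOverlaps {n : ℕ} (ψ : QubitSpace n) : Set ℝ :=
  {x | ∃ U : Fin n → Matrix (Fin 2) (Fin 2) ℂ, (∀ i, U i ∈ Matrix.unitaryGroup (Fin 2) ℂ) ∧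
    x = ‖braket (conjState ψ) (tensorOp U) ψ‖ ^ 2}

/-- The values `|⟨ψ*| P |ψ⟩|²`, over all elements `P` of the Pauli group. -/
def pauliOverlaps {n : ℕ} (ψ : QubitSpace n) : Set ℝ :=
  {x | ∃ P ∈ pauliGroup n, x = ‖braket (conjState ψ) P ψ‖ ^ 2}

/-- The fidelities `|⟨φ|ψ⟩|²`, over all pure stabilizer states `φ`. -/
def stabilizerOverlaps {n : ℕ} (ψ : QubitSpace n) : Set ℝ :=
  {x | ∃ φ : QubitSpace n, IsStabilizerState φ ∧ x = ‖inner ℂ φ ψ‖ ^ 2}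

/-- The `n`-partite chiral log-distance `C`. -/
def chiralLogDistance {n : ℕ} (ψ : QubitSpace n) : ℝ :=
  -Real.logb 2 (sSup (localOverlaps ψ))

/-- The Pauli-restricted chiral log-distance `C_P`. -/
def pauliChiralLogDistance {n : ℕ} (ψ : QubitSpace n) : ℝ :=
  -Real.logb 2 (sSup (pauliOverlaps ψ))

/-- The stabilizer fidelity `F`. -/
def stabilizerFidelity {n : ℕ} (ψ : QubitSpace n) : ℝ :=
  sSup (stabilizerOverlaps ψ)

/-- The Pauli strings (with phase `+1`) that take a definite value `±1` in the state `ψ`. -/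
def definitePauliStrings {n : ℕ} (ψ : QubitSpace n) : Set (QubitOp n) :=
  {P | P ∈ pauliStrings n ∧ (braket ψ P ψ = 1 ∨ braket ψ P ψ = -1)}

/-- The stabilizer nullity `ν = n - k`, where `2 ^ k` is the number of Pauli strings that take a
definite value in `ψ`. -/
def stabilizerNullity {n : ℕ} (ψ : QubitSpace n) : ℤ :=
  (n : ℤ) - (Nat.log 2 (definitePauliStrings ψ).ncard : ℤ)

end ChiralityMagic

end

open ChiralityMagic

/-!
Pauli strings are labelled by `u : Fin n → ZMod 2 × ZMod 2`, so that products of strings are, up to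
phase, sums of labels. Write `x_u = ⟨ψ*|P_u|ψ⟩` and `r_v = ⟨ψ|P_v|ψ⟩` for a unit vector `ψ`.

* Pauli strings form an orthogonal operator basis (`sum_star_braket_mul_braket`), hence
  `∑ |x_u|² = 2 ^ n`.
* One-qubit index reshuffling shows that `2 ^ n |x_u|² = ∑ v, ± r_v²` with a matrix of signs whose
  columns are orthogonal (`norm_sq_braket_conjState`), so Parseval's identity gives
  `∑ |x_u|⁴ = ∑ r_v⁴` (`sum_norm_pow_four_braket_conjState`).
* The right-hand side is at least the number of strings with definite value, so the maximum of
  `|x_u|²`, which is at least the ratio of fourth to second moment, is at least `2 ^ k / 2 ^ n`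
  (`card_eigenLabels_le_sSup`). This is `C_P ≤ ν`. The definite strings are counted by a subgroup
  of the group of labels, hence their number is a power of two.
* The products of the generators of a stabilizer state `φ` have `2 ^ n` distinct labels
  (`IsStabilizerState.two_pow_le_card`), so for `φ` the second and fourth moments agree and every
  `|⟨φ*|P_u|φ⟩|` is `0` or `1`. Expanding
  `2 ^ n ⟨φ|ψ⟩² = ∑ conj ⟨φ*|P_u|φ⟩ ⟨ψ*|P_u|ψ⟩` by the orthogonality relations then bounds
  `|⟨φ|ψ⟩|²` by the maximum of `|x_u|` (`IsStabilizerState.norm_sq_inner_sq_le`). This is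
  `C_P ≤ -2 log F`.

The maxima are attained by compactness: local unitaries form a compact set, the Pauli group is
finite, and the stabilizer states form a finite union of compact sets. The fidelity is positive
because the computational basis consists of stabilizer states.
-/

open Matrix

namespace ChiralityMagic

/-! ### Tensor products of one-qubit operators -/

theorem sum_pi_prod {R κ ι : Type*} [CommSemiring R] [Fintype κ] [Fintype ι] [DecidableEq ι]
    (F : ι → κ → R) : ∑ u : ι → κ, ∏ i, F i (u i) = ∏ i, ∑ k, F i k := by
  rw [Finset.prod_univ_sum, Fintype.piFinset_univ]

theorem tensorOp_apply {n : ℕ} (U : Fin n → Matrix (Fin 2) (Fin 2) ℂ) (s t : Fin n → Fin 2) :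
    tensorOp U s t = ∏ i, U i (s i) (t i) := rfl

theorem tensorOp_mul {n : ℕ} (U V : Fin n → Matrix (Fin 2) (Fin 2) ℂ) :
    tensorOp U * tensorOp V = tensorOp fun i => U i * V i := by
  ext s t
  simp only [Matrix.mul_apply, tensorOp_apply, ← Finset.prod_mul_distrib]
  exact sum_pi_prod fun i k => U i (s i) k * V i k (t i)

theorem tensorOp_one {n : ℕ} : tensorOp (fun _ : Fin n => (1 : Matrix (Fin 2) (Fin 2) ℂ)) = 1 := by
  ext s t
  simp only [tensorOp_apply, Matrix.one_apply, Finset.prod_ite_zero]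
  simp [funext_iff]

theorem tensorOp_smul {n : ℕ} (c : Fin n → ℂ) (U : Fin n → Matrix (Fin 2) (Fin 2) ℂ) :
    tensorOp (fun i => c i • U i) = (∏ i, c i) • tensorOp U := by
  ext s t
  simp [tensorOp_apply, Finset.prod_mul_distrib]

theorem conjTranspose_tensorOp {n : ℕ} (U : Fin n → Matrix (Fin 2) (Fin 2) ℂ) :
    (tensorOp U)ᴴ = tensorOp fun i => (U i)ᴴ := by
  ext s t
  simp [tensorOp_apply, Matrix.conjTranspose_apply]

theorem trace_tensorOp {n : ℕ} (U : Fin n → Matrix (Fin 2) (Fin 2) ℂ) :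
    (tensorOp U).trace = ∏ i, (U i).trace := by
  simp only [Matrix.trace, Matrix.diag, tensorOp_apply]
  exact sum_pi_prod fun i k => U i k k

theorem tensorOp_mem_unitaryGroup {n : ℕ} {U : Fin n → Matrix (Fin 2) (Fin 2) ℂ}
    (hU : ∀ i, U i ∈ Matrix.unitaryGroup (Fin 2) ℂ) :
    tensorOp U ∈ Matrix.unitaryGroup (Fin n → Fin 2) ℂ := by
  rw [Matrix.mem_unitaryGroup_iff, Matrix.star_eq_conjTranspose, conjTranspose_tensorOp,
    tensorOp_mul, ← tensorOp_one]
  congr 1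
  funext i
  exact Matrix.mem_unitaryGroup_iff.1 (hU i)

/-! ### Matrix elements -/

theorem braket_eq_sum {n : ℕ} (φ ψ : QubitSpace n) (A : QubitOp n) :
    braket φ A ψ = ∑ s, ∑ t, star (φ s) * A s t * ψ t := by
  simp only [braket, PiLp.inner_apply, Matrix.mulVec, dotProduct, RCLike.inner_apply,
    Finset.sum_mul]
  refine Finset.sum_congr rfl fun s _ => Finset.sum_congr rfl fun t _ => ?_
  simp only [RCLike.star_def]
  ring

theorem braket_smul_op {n : ℕ} (φ ψ : QubitSpace n) (c : ℂ) (A : QubitOp n) :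
    braket φ (c • A) ψ = c * braket φ A ψ := by
  simp only [braket_eq_sum, Finset.mul_sum, Matrix.smul_apply, smul_eq_mul]
  refine Finset.sum_congr rfl fun s _ => Finset.sum_congr rfl fun t _ => ?_
  ring

theorem inner_eq_sum {n : ℕ} (φ ψ : QubitSpace n) :
    inner ℂ φ ψ = ∑ s, star (φ s) * ψ s := by
  simp only [PiLp.inner_apply, RCLike.inner_apply, RCLike.star_def, mul_comm]

theorem norm_conjState {n : ℕ} (ψ : QubitSpace n) : ‖conjState ψ‖ = ‖ψ‖ := by
  simp [EuclideanSpace.norm_eq, conjState]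

theorem inner_conjState {n : ℕ} (φ ψ : QubitSpace n) :
    inner ℂ (conjState φ) (conjState ψ) = inner ℂ ψ φ := by
  simp only [inner_eq_sum, conjState, star_star, mul_comm]

theorem norm_mulVec_of_mem_unitaryGroup {n : ℕ} {A : QubitOp n}
    (hA : A ∈ Matrix.unitaryGroup (Fin n → Fin 2) ℂ) (ψ : QubitSpace n) :
    ‖(WithLp.toLp 2 (A *ᵥ ψ.ofLp) : QubitSpace n)‖ = ‖ψ‖ := by
  have h : inner ℂ (WithLp.toLp 2 (A *ᵥ ψ.ofLp) : QubitSpace n) (WithLp.toLp 2 (A *ᵥ ψ.ofLp))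
      = inner ℂ ψ ψ := by
    rw [EuclideanSpace.inner_eq_star_dotProduct, EuclideanSpace.inner_eq_star_dotProduct,
      Matrix.star_mulVec, dotProduct_comm, ← Matrix.dotProduct_mulVec, Matrix.mulVec_mulVec,
      ← Matrix.star_eq_conjTranspose, Matrix.mem_unitaryGroup_iff'.1 hA, Matrix.one_mulVec,
      dotProduct_comm]
  rw [@norm_eq_sqrt_re_inner ℂ, @norm_eq_sqrt_re_inner ℂ _ _ _ _ ψ, h]

theorem norm_braket_le {n : ℕ} {A : QubitOp n} (hA : A ∈ Matrix.unitaryGroup (Fin n → Fin 2) ℂ)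
    (φ ψ : QubitSpace n) : ‖braket φ A ψ‖ ≤ ‖φ‖ * ‖ψ‖ := by
  rw [← norm_mulVec_of_mem_unitaryGroup hA ψ]
  exact norm_inner_le_norm _ _

/-! ### Pauli strings indexed by an elementary abelian `2`-group -/

/-- The one-qubit Pauli operators, up to phase `X ^ u.1 * Z ^ u.2`, labelled by the Klein four-group
so that products of Pauli operators correspond, up to phase, to sums of labels. -/
def kleinPauli (u : ZMod 2 × ZMod 2) : Matrix (Fin 2) (Fin 2) ℂ :=
  pauli ((![![0, 3], ![1, 2]] : Fin 2 → Fin 2 → Fin 4) u.1 u.2)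

/-- The Pauli string with label `u`. -/
def pauliString {n : ℕ} (u : Fin n → ZMod 2 × ZMod 2) : QubitOp n :=
  tensorOp fun i => kleinPauli (u i)

theorem klein_forall {p : ZMod 2 × ZMod 2 → Prop} :
    (∀ u, p u) ↔ (p (0, 0) ∧ p (0, 1)) ∧ p (1, 0) ∧ p (1, 1) := by
  refine ⟨fun h => ⟨⟨h _, h _⟩, h _, h _⟩, ?_⟩
  rintro ⟨⟨h1, h2⟩, h3, h4⟩ ⟨a, b⟩
  fin_cases a <;> fin_cases b <;> assumption

theorem klein_sum {R : Type*} [AddCommMonoid R] (f : ZMod 2 × ZMod 2 → R) :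
    ∑ u, f u = f (0, 0) + f (0, 1) + (f (1, 0) + f (1, 1)) := by
  rw [Fintype.sum_prod_type]
  exact (Fin.sum_univ_two _).trans (congr_arg₂ _ (Fin.sum_univ_two _) (Fin.sum_univ_two _))

theorem kleinPauli_zero_zero : kleinPauli (0, 0) = !![1, 0; 0, 1] := by
  rw [← Matrix.one_fin_two]; rfl
theorem kleinPauli_zero_one : kleinPauli (0, 1) = !![1, 0; 0, -1] := rfl
theorem kleinPauli_one_zero : kleinPauli (1, 0) = !![0, 1; 1, 0] := rfl
theorem kleinPauli_one_one : kleinPauli (1, 1) = !![0, -Complex.I; Complex.I, 0] := rfl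

theorem exists_kleinPauli_eq (k : Fin 4) : ∃ u, kleinPauli u = pauli k := by
  fin_cases k
  exacts [⟨(0, 0), rfl⟩, ⟨(1, 0), rfl⟩, ⟨(1, 1), rfl⟩, ⟨(0, 1), rfl⟩]

theorem kleinPauli_zero : kleinPauli 0 = 1 := rfl

theorem conjTranspose_kleinPauli (u : ZMod 2 × ZMod 2) : (kleinPauli u)ᴴ = kleinPauli u := by
  revert u
  simp only [klein_forall, kleinPauli_zero_zero, kleinPauli_zero_one, kleinPauli_one_zero,
    kleinPauli_one_one]
  refine ⟨⟨?_, ?_⟩, ?_, ?_⟩ <;> ext i j <;> fin_cases i <;> fin_cases j <;>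
    simp [Matrix.conjTranspose_apply]

theorem kleinPauli_mul_self (u : ZMod 2 × ZMod 2) : kleinPauli u * kleinPauli u = 1 := by
  revert u
  simp only [klein_forall, kleinPauli_zero_zero, kleinPauli_zero_one, kleinPauli_one_zero,
    kleinPauli_one_one]
  simp [Matrix.one_fin_two]

theorem exists_kleinPauli_mul (u v : ZMod 2 × ZMod 2) :
    ∃ c : ℂ, c ≠ 0 ∧ kleinPauli u * kleinPauli v = c • kleinPauli (u + v) := by
  have h2 : (1 + 1 : ZMod 2) = 0 := rfl
  revert u v
  simp only [klein_forall, Prod.mk_add_mk, add_zero, zero_add, h2, kleinPauli_zero_zero,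
    kleinPauli_zero_one, kleinPauli_one_zero, kleinPauli_one_one]
  refine ⟨⟨⟨⟨⟨1, ?_⟩, 1, ?_⟩, ⟨1, ?_⟩, 1, ?_⟩, ⟨⟨1, ?_⟩, 1, ?_⟩, ⟨Complex.I, ?_⟩, -Complex.I, ?_⟩,
    ⟨⟨⟨1, ?_⟩, -Complex.I, ?_⟩, ⟨1, ?_⟩, Complex.I, ?_⟩, ⟨⟨1, ?_⟩, Complex.I, ?_⟩,
    ⟨-Complex.I, ?_⟩, 1, ?_⟩ <;> simp

theorem trace_kleinPauli (u : ZMod 2 × ZMod 2) :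
    (kleinPauli u).trace = if u = 0 then 2 else 0 := by
  revert u
  simp only [klein_forall, kleinPauli_zero_zero, kleinPauli_zero_one, kleinPauli_one_zero,
    kleinPauli_one_one]
  simp [Matrix.trace_fin_two]
  norm_num

/-- Completeness of the Pauli basis, entrywise. -/
theorem kleinPauli_complete (a b c d : Fin 2) :
    ∑ u, star (kleinPauli u a b) * kleinPauli u c d =
      (if a = c then 1 else 0) * (if b = d then 1 else 0) * 2 := by
  rw [klein_sum, kleinPauli_zero_zero, kleinPauli_zero_one, kleinPauli_one_zero,
    kleinPauli_one_one]
  fin_cases a <;> fin_cases b <;> fin_cases c <;> fin_cases d <;> simp <;> norm_num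

/-- The sign `(-1) ^ (u.1 * v.2 + u.2 * v.1 + v.1 * v.2)`: the commutation sign of the Pauli
operators labelled by `u` and `v`, times the sign of the latter under transposition. -/
def kleinSign (u v : ZMod 2 × ZMod 2) : ℝ :=
  if u.1 * v.2 + u.2 * v.1 + v.1 * v.2 = 0 then 1 else -1

theorem kleinSign_complete (v w : ZMod 2 × ZMod 2) :
    ∑ u, kleinSign u v * kleinSign u w = if v = w then 4 else 0 := by
  have h2 : (1 + 1 : ZMod 2) = 0 := rfl
  simp only [klein_sum, kleinSign]
  revert v w
  simp only [klein_forall]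
  simp [h2]
  norm_num

/-- Reshuffling the indices of `star σ ⊗ σ` expands it in the operators `σ' ⊗ σ'`. -/
theorem kleinPauli_reshuffle (u : ZMod 2 × ZMod 2) (a b c d : Fin 2) :
    2 * (star (kleinPauli u a b) * kleinPauli u c d) =
      ∑ v, (kleinSign u v : ℂ) * (kleinPauli v a c * kleinPauli v b d) := by
  have h2 : (1 + 1 : ZMod 2) = 0 := rfl
  rw [klein_sum, kleinPauli_zero_zero, kleinPauli_zero_one, kleinPauli_one_zero,
    kleinPauli_one_one]
  revert u
  simp only [klein_forall, kleinSign, kleinPauli_zero_zero, kleinPauli_zero_one,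
    kleinPauli_one_zero, kleinPauli_one_one]
  fin_cases a <;> fin_cases b <;> fin_cases c <;> fin_cases d <;> simp [h2] <;> norm_num

variable {n : ℕ}

theorem conjTranspose_pauliString (u : Fin n → ZMod 2 × ZMod 2) :
    (pauliString u)ᴴ = pauliString u := by
  simp only [pauliString, conjTranspose_tensorOp, conjTranspose_kleinPauli]

theorem pauliString_mul_self (u : Fin n → ZMod 2 × ZMod 2) :
    pauliString u * pauliString u = 1 := by
  simp only [pauliString, tensorOp_mul, kleinPauli_mul_self, tensorOp_one]

theorem pauliString_zero : pauliString (0 : Fin n → ZMod 2 × ZMod 2) = 1 :=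
  tensorOp_one

theorem kleinPauli_mem_unitaryGroup (u : ZMod 2 × ZMod 2) :
    kleinPauli u ∈ Matrix.unitaryGroup (Fin 2) ℂ := by
  rw [Matrix.mem_unitaryGroup_iff, Matrix.star_eq_conjTranspose, conjTranspose_kleinPauli,
    kleinPauli_mul_self]

theorem pauliString_mem_unitaryGroup (u : Fin n → ZMod 2 × ZMod 2) :
    pauliString u ∈ Matrix.unitaryGroup (Fin n → Fin 2) ℂ :=
  tensorOp_mem_unitaryGroup fun _ => kleinPauli_mem_unitaryGroup _

theorem exists_pauliString_mul (u v : Fin n → ZMod 2 × ZMod 2) :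
    ∃ c : ℂ, c ≠ 0 ∧ pauliString u * pauliString v = c • pauliString (u + v) := by
  choose c hc h using fun i => exists_kleinPauli_mul (u i) (v i)
  refine ⟨∏ i, c i, Finset.prod_ne_zero_iff.2 fun i _ => hc i, ?_⟩
  simp only [pauliString, tensorOp_mul, h, tensorOp_smul, Pi.add_apply]

theorem add_self_eq_zero (u : Fin n → ZMod 2 × ZMod 2) : u + u = 0 := by
  funext i
  exact Prod.ext (CharTwo.add_self_eq_zero _) (CharTwo.add_self_eq_zero _)

theorem eq_of_add_eq_zero {u v : Fin n → ZMod 2 × ZMod 2} (h : u + v = 0) : u = v := by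
  rw [← add_right_cancel_iff (a := v), h, add_self_eq_zero]

theorem trace_pauliString (u : Fin n → ZMod 2 × ZMod 2) :
    (pauliString u).trace = if u = 0 then 2 ^ n else 0 := by
  simp only [pauliString, trace_tensorOp, trace_kleinPauli, Finset.prod_ite_zero]
  simp [funext_iff]

/-- Distinct labels give Pauli strings that are not proportional, because they are orthogonal for
the trace form. -/
theorem eq_of_pauliString_eq_smul {u v : Fin n → ZMod 2 × ZMod 2} {c : ℂ}
    (h : pauliString u = c • pauliString v) : u = v := by
  obtain ⟨d, -, hd⟩ := exists_pauliString_mul u v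
  by_contra hne
  have h0 : u + v ≠ 0 := fun h => hne (eq_of_add_eq_zero h)
  have h1 : pauliString u * pauliString u = (c * d) • pauliString (u + v) := by
    nth_rw 2 [h]
    rw [mul_smul_comm, hd, smul_smul]
  rw [pauliString_mul_self, ← pauliString_zero] at h1
  have h2 := congr_arg Matrix.trace h1
  rw [Matrix.trace_smul, trace_pauliString, trace_pauliString, if_pos rfl, if_neg h0,
    smul_zero] at h2
  exact pow_ne_zero n two_ne_zero h2

theorem pauliString_injective :
    Function.Injective (pauliString : (Fin n → ZMod 2 × ZMod 2) → QubitOp n) := fun u v h =>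
  eq_of_pauliString_eq_smul (c := 1) (by rw [h, one_smul])

theorem pauliStrings_eq_range :
    pauliStrings n = Set.range (pauliString : (Fin n → ZMod 2 × ZMod 2) → QubitOp n) := by
  ext P
  constructor
  · rintro ⟨p, rfl⟩
    choose u hu using fun i => exists_kleinPauli_eq (p i)
    exact ⟨u, by simp only [pauliString, hu]⟩
  · rintro ⟨u, rfl⟩
    exact ⟨fun i => _, rfl⟩

theorem mem_pauliGroup_iff {P : QubitOp n} :
    P ∈ pauliGroup n ↔ ∃ c : ℂ, (c = 1 ∨ c = -1 ∨ c = Complex.I ∨ c = -Complex.I) ∧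
      ∃ u, P = c • pauliString u := by
  simp [pauliGroup, pauliStrings_eq_range]

theorem norm_phase {c : ℂ} (hc : c = 1 ∨ c = -1 ∨ c = Complex.I ∨ c = -Complex.I) : ‖c‖ = 1 := by
  rcases hc with rfl | rfl | rfl | rfl <;> simp

theorem finite_pauliGroup : (pauliGroup n).Finite := by
  refine (Set.Finite.image2 (fun (c : ℂ) (u : Fin n → ZMod 2 × ZMod 2) => c • pauliString u)
    (Set.toFinite {1, -1, Complex.I, -Complex.I}) Set.finite_univ).subset ?_
  intro P hP
  obtain ⟨c, hc, u, rfl⟩ := mem_pauliGroup_iff.1 hP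
  exact ⟨c, hc, u, Set.mem_univ _, rfl⟩

theorem pauliOverlaps_eq_range (ψ : QubitSpace n) :
    pauliOverlaps ψ =
      Set.range fun u => ‖braket (conjState ψ) (pauliString u) ψ‖ ^ 2 := by
  ext x
  constructor
  · rintro ⟨P, hP, rfl⟩
    obtain ⟨c, hc, u, rfl⟩ := mem_pauliGroup_iff.1 hP
    exact ⟨u, by simp only [braket_smul_op, norm_mul, norm_phase hc, one_mul]⟩
  · rintro ⟨u, rfl⟩
    exact ⟨_, mem_pauliGroup_iff.2 ⟨1, Or.inl rfl, u, (one_smul _ _).symm⟩, rfl⟩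

/-! ### Completeness relations for Pauli strings -/

theorem pauliString_complete (s t s' t' : Fin n → Fin 2) :
    ∑ u, star (pauliString u s t) * pauliString u s' t' =
      (if s = s' then 1 else 0) * (if t = t' then 1 else 0) * 2 ^ n := by
  simp only [pauliString, tensorOp_apply, star_prod, ← Finset.prod_mul_distrib]
  rw [sum_pi_prod fun i k => star (kleinPauli k (s i) (t i)) * kleinPauli k (s' i) (t' i)]
  simp only [kleinPauli_complete, Finset.prod_mul_distrib, Finset.prod_ite_zero]
  simp [funext_iff]

/-- Matrix elements of the Pauli strings satisfy the orthogonality relations of an operator basis. -/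
theorem sum_star_braket_mul_braket (a b c d : QubitSpace n) :
    ∑ u, star (braket c (pauliString u) d) * braket a (pauliString u) b =
      2 ^ n * (inner ℂ a c * inner ℂ d b) := by
  have h : ∀ u : Fin n → ZMod 2 × ZMod 2,
      star (braket c (pauliString u) d) * braket a (pauliString u) b =
      ∑ s, ∑ t, ∑ s', ∑ t', (c s * star (d t) * star (a s') * b t') *
        (star (pauliString u s t) * pauliString u s' t') := by
    intro u
    simp only [braket_eq_sum, star_sum, Finset.sum_mul]
    refine Finset.sum_congr rfl fun s _ => Finset.sum_congr rfl fun t _ => ?_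
    simp only [Finset.mul_sum]
    refine Finset.sum_congr rfl fun s' _ => Finset.sum_congr rfl fun t' _ => ?_
    simp only [star_mul', star_star]
    ring
  simp only [h]
  rw [Finset.sum_comm]
  simp only [Finset.sum_comm (s := (Finset.univ : Finset (Fin n → ZMod 2 × ZMod 2))),
    ← Finset.mul_sum, pauliString_complete]
  rw [inner_eq_sum, inner_eq_sum, Finset.sum_mul_sum, Finset.mul_sum]
  simp only [Finset.mul_sum]
  refine Finset.sum_congr rfl fun s _ => Finset.sum_congr rfl fun t _ => ?_
  rw [Finset.sum_eq_single s (fun s' _ hs' => by simp [hs'.symm]) (by simp),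
    Finset.sum_eq_single t (fun t' _ ht' => by simp [ht'.symm]) (by simp)]
  simp only [if_true]
  ring

/-- The product of the signs `kleinSign` over all qubits: the commutation sign of the Pauli strings
labelled by `u` and `v`, times the sign of the latter under transposition. -/
def pauliSign (u v : Fin n → ZMod 2 × ZMod 2) : ℝ := ∏ i, kleinSign (u i) (v i)

theorem pauliSign_complete (v w : Fin n → ZMod 2 × ZMod 2) :
    ∑ u, pauliSign u v * pauliSign u w = if v = w then 4 ^ n else 0 := by
  simp only [pauliSign, ← Finset.prod_mul_distrib]
  rw [sum_pi_prod fun i k => kleinSign k (v i) * kleinSign k (w i)]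
  simp only [kleinSign_complete, Finset.prod_ite_zero]
  simp [funext_iff]

theorem pauliString_reshuffle (u : Fin n → ZMod 2 × ZMod 2) (s t s' t' : Fin n → Fin 2) :
    2 ^ n * (star (pauliString u s t) * pauliString u s' t') =
      ∑ v, (pauliSign u v : ℂ) * (pauliString v s s' * pauliString v t t') := by
  simp only [pauliString, tensorOp_apply, star_prod, pauliSign, Complex.ofReal_prod,
    ← Finset.prod_mul_distrib]
  rw [sum_pi_prod fun i k => (kleinSign (u i) k : ℂ) *
    (kleinPauli k (s i) (s' i) * kleinPauli k (t i) (t' i))]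
  simp only [← kleinPauli_reshuffle, Finset.prod_mul_distrib]
  simp

/-- The overlaps of `ψ*` with `P ψ` are a signed Fourier transform of the squared expectation
values of the Pauli strings in `ψ`. -/
theorem norm_sq_braket_conjState (u : Fin n → ZMod 2 × ZMod 2) (ψ : QubitSpace n) :
    2 ^ n * ((‖braket (conjState ψ) (pauliString u) ψ‖ ^ 2 : ℝ) : ℂ) =
      ∑ v, (pauliSign u v : ℂ) * braket ψ (pauliString v) ψ ^ 2 := by
  have h0 : ((‖braket (conjState ψ) (pauliString u) ψ‖ ^ 2 : ℝ) : ℂ) =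
      star (braket (conjState ψ) (pauliString u) ψ) * braket (conjState ψ) (pauliString u) ψ := by
    rw [RCLike.star_def, Complex.conj_mul', Complex.ofReal_pow]
  have h1 : ((‖braket (conjState ψ) (pauliString u) ψ‖ ^ 2 : ℝ) : ℂ) =
      ∑ s, ∑ t, ∑ s', ∑ t', (star (ψ s) * star (ψ t) * ψ s' * ψ t') *
        (star (pauliString u s t) * pauliString u s' t') := by
    rw [h0]
    simp only [braket_eq_sum, star_sum, Finset.sum_mul]
    refine Finset.sum_congr rfl fun s _ => Finset.sum_congr rfl fun t _ => ?_
    simp only [Finset.mul_sum]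
    refine Finset.sum_congr rfl fun s' _ => Finset.sum_congr rfl fun t' _ => ?_
    simp only [star_mul', star_star, conjState]
    ring
  have h2 : ∀ v : Fin n → ZMod 2 × ZMod 2, braket ψ (pauliString v) ψ ^ 2 =
      ∑ s, ∑ t, ∑ s', ∑ t', (star (ψ s) * star (ψ t) * ψ s' * ψ t') *
        (pauliString v s s' * pauliString v t t') := by
    intro v
    rw [sq]
    simp only [braket_eq_sum, Finset.sum_mul]
    refine Finset.sum_congr rfl fun s _ => ?_
    simp only [Finset.mul_sum]
    rw [Finset.sum_comm]
    refine Finset.sum_congr rfl fun t _ => Finset.sum_congr rfl fun s' _ =>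
      Finset.sum_congr rfl fun t' _ => ?_
    ring
  rw [h1]
  simp only [h2, Finset.mul_sum]
  simp only [Finset.sum_comm (s := (Finset.univ : Finset (Fin n → ZMod 2 × ZMod 2)))]
  refine Finset.sum_congr rfl fun s _ => Finset.sum_congr rfl fun t _ =>
    Finset.sum_congr rfl fun s' _ => Finset.sum_congr rfl fun t' _ => ?_
  rw [mul_left_comm, pauliString_reshuffle, Finset.mul_sum]
  refine Finset.sum_congr rfl fun v _ => ?_
  ring

/-! ### The group of Pauli strings with a definite value -/

/-- The labels of the Pauli strings that have `ψ` as an eigenvector. -/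
def eigenLabels (ψ : QubitSpace n) : AddSubgroup (Fin n → ZMod 2 × ZMod 2) where
  carrier := {u | ∃ c : ℂ, pauliString u *ᵥ ψ.ofLp = c • ψ.ofLp}
  zero_mem' := ⟨1, by rw [pauliString_zero, Matrix.one_mulVec, one_smul]⟩
  add_mem' := by
    rintro u v ⟨a, ha⟩ ⟨b, hb⟩
    obtain ⟨c, hc, h⟩ := exists_pauliString_mul u v
    refine ⟨c⁻¹ * (b * a), ?_⟩
    rw [← inv_smul_smul₀ hc (pauliString (u + v)), ← h, Matrix.smul_mulVec,
      ← Matrix.mulVec_mulVec, hb, Matrix.mulVec_smul, ha, smul_smul, smul_smul, mul_assoc]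
  neg_mem' := by
    intro u hu
    rwa [neg_eq_of_add_eq_zero_right (add_self_eq_zero u)]

theorem mem_eigenLabels {ψ : QubitSpace n} {u : Fin n → ZMod 2 × ZMod 2} :
    u ∈ eigenLabels ψ ↔ ∃ c : ℂ, pauliString u *ᵥ ψ.ofLp = c • ψ.ofLp := Iff.rfl

theorem braket_eq_one_or_neg_one_iff {ψ : QubitSpace n} (hψ : ‖ψ‖ = 1)
    (u : Fin n → ZMod 2 × ZMod 2) :
    (braket ψ (pauliString u) ψ = 1 ∨ braket ψ (pauliString u) ψ = -1) ↔ u ∈ eigenLabels ψ := by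
  have hP := (norm_mulVec_of_mem_unitaryGroup (pauliString_mem_unitaryGroup u) ψ).trans hψ
  rw [mem_eigenLabels]
  constructor
  · rintro (h | h)
    · have h1 := (inner_eq_one_iff_of_norm_eq_one hψ hP).1 h
      refine ⟨1, ?_⟩
      rw [one_smul]
      conv_rhs => rw [h1]
    · have h1 := (inner_eq_one_iff_of_norm_eq_one (𝕜 := ℂ) (x := -ψ) (by rwa [norm_neg]) hP).1
        (by rw [inner_neg_left, ← neg_neg (1 : ℂ), ← h]; rfl)
      refine ⟨-1, ?_⟩
      have h2 := congr_arg WithLp.ofLp h1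
      simp only [WithLp.ofLp_neg] at h2
      rw [← h2, neg_smul, one_smul]
  · rintro ⟨c, hc⟩
    have hψ0 : ψ.ofLp ≠ 0 := fun h => by
      have : ψ = 0 := WithLp.ofLp_injective 2 h
      simp [this] at hψ
    have hb : braket ψ (pauliString u) ψ = c := by
      rw [braket, hc, WithLp.toLp_smul, inner_smul_right]
      simp [inner_self_eq_norm_sq_to_K, hψ]
    rw [hb]
    have h1 : (c * c) • ψ.ofLp = (1 : ℂ) • ψ.ofLp := by
      rw [one_smul, ← smul_smul, ← hc, ← Matrix.mulVec_smul, ← hc, Matrix.mulVec_mulVec,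
        pauliString_mul_self, Matrix.one_mulVec]
    exact mul_self_eq_one_iff.1 (smul_left_injective ℂ hψ0 h1)

theorem ncard_definitePauliStrings {ψ : QubitSpace n} (hψ : ‖ψ‖ = 1) :
    (definitePauliStrings ψ).ncard = Nat.card (eigenLabels ψ) := by
  have h : definitePauliStrings ψ =
      pauliString '' (eigenLabels ψ : Set (Fin n → ZMod 2 × ZMod 2)) := by
    ext P
    simp only [definitePauliStrings, pauliStrings_eq_range, Set.mem_ofPred_eq, Set.mem_image,
      SetLike.mem_coe]
    constructor
    · rintro ⟨⟨u, rfl⟩, h⟩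
      exact ⟨u, (braket_eq_one_or_neg_one_iff hψ u).1 h, rfl⟩
    · rintro ⟨u, hu, rfl⟩
      exact ⟨⟨u, rfl⟩, (braket_eq_one_or_neg_one_iff hψ u).2 hu⟩
  rw [h, Set.ncard_image_of_injective _ pauliString_injective, ← Nat.card_coe_set_eq]
  rfl

theorem exists_card_eigenLabels (ψ : QubitSpace n) :
    ∃ k, Nat.card (eigenLabels ψ) = 2 ^ k := by
  have h := AddSubgroup.card_addSubgroup_dvd_card (eigenLabels ψ)
  have h2 : Nat.card (Fin n → ZMod 2 × ZMod 2) = 2 ^ (2 * n) := by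
    simp [Nat.card_eq_fintype_card, pow_mul]
  rw [h2, Nat.dvd_prime_pow Nat.prime_two] at h
  exact ⟨h.choose, h.choose_spec.2⟩

/-! ### Moments of the overlaps with the conjugate state -/

theorem star_braket_pauliString (ψ : QubitSpace n) (u : Fin n → ZMod 2 × ZMod 2) :
    star (braket ψ (pauliString u) ψ) = braket ψ (pauliString u) ψ := by
  have h : ∀ s t, star (pauliString u s t) = pauliString u t s := fun s t => by
    rw [← Matrix.conjTranspose_apply, conjTranspose_pauliString]
  simp only [braket_eq_sum, star_sum, star_mul', star_star, h]
  rw [Finset.sum_comm]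
  refine Finset.sum_congr rfl fun s _ => Finset.sum_congr rfl fun t _ => ?_
  ring

theorem ofReal_re_braket (ψ : QubitSpace n) (u : Fin n → ZMod 2 × ZMod 2) :
    ((braket ψ (pauliString u) ψ).re : ℂ) = braket ψ (pauliString u) ψ :=
  Complex.conj_eq_iff_re.1 (star_braket_pauliString ψ u)

theorem sum_norm_sq_braket (a b : QubitSpace n) :
    ∑ u, ‖braket a (pauliString u) b‖ ^ 2 = 2 ^ n * (‖a‖ ^ 2 * ‖b‖ ^ 2) := by
  have h := sum_star_braket_mul_braket a b a b
  simp only [RCLike.star_def, Complex.conj_mul', inner_self_eq_norm_sq_to_K] at h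
  apply Complex.ofReal_injective
  push_cast
  exact h

/-- Parseval's identity for the signed Fourier transform `norm_sq_braket_conjState`. -/
theorem sum_norm_pow_four_braket_conjState (ψ : QubitSpace n) :
    ∑ u, (‖braket (conjState ψ) (pauliString u) ψ‖ ^ 2) ^ 2 =
      ∑ v, (braket ψ (pauliString v) ψ).re ^ 4 := by
  obtain ⟨r, hr⟩ : ∃ r : (Fin n → ZMod 2 × ZMod 2) → ℝ,
      ∀ v, braket ψ (pauliString v) ψ = (r v : ℂ) :=
    ⟨_, fun v => (ofReal_re_braket ψ v).symm⟩
  simp only [hr, Complex.ofReal_re]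
  have h : ∀ u, 2 ^ n * ‖braket (conjState ψ) (pauliString u) ψ‖ ^ 2 =
      ∑ v, pauliSign u v * r v ^ 2 := by
    intro u
    have := norm_sq_braket_conjState u ψ
    simp only [hr] at this
    apply Complex.ofReal_injective
    push_cast
    simpa using this
  have h4 : (4 : ℝ) ^ n = 2 ^ n * 2 ^ n := by rw [← mul_pow]; norm_num
  have h5 : (4 : ℝ) ^ n ≠ 0 := by positivity
  refine mul_left_cancel₀ h5 ?_
  calc (4 : ℝ) ^ n * ∑ u, (‖braket (conjState ψ) (pauliString u) ψ‖ ^ 2) ^ 2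
      = ∑ u, (∑ v, pauliSign u v * r v ^ 2) * ∑ w, pauliSign u w * r w ^ 2 := by
        rw [Finset.mul_sum]
        refine Finset.sum_congr rfl fun u _ => ?_
        rw [← h, h4]
        ring
    _ = ∑ v, ∑ w, (r v ^ 2 * r w ^ 2) * ∑ u, pauliSign u v * pauliSign u w := by
        rw [Finset.sum_congr rfl fun u _ => Finset.sum_mul_sum _ _ _ _, Finset.sum_comm]
        simp only [Finset.mul_sum]
        refine Finset.sum_congr rfl fun v _ => ?_
        rw [Finset.sum_comm]
        refine Finset.sum_congr rfl fun w _ => Finset.sum_congr rfl fun u _ => ?_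
        ring
    _ = 4 ^ n * ∑ v, r v ^ 4 := by
        simp only [pauliSign_complete, mul_ite, mul_zero, Finset.sum_ite_eq, Finset.mem_univ,
          if_true, Finset.mul_sum]
        refine Finset.sum_congr rfl fun v _ => ?_
        ring

theorem card_eigenLabels_le_sum {ψ : QubitSpace n} (hψ : ‖ψ‖ = 1) :
    (Nat.card (eigenLabels ψ) : ℝ) ≤
      ∑ u, (‖braket (conjState ψ) (pauliString u) ψ‖ ^ 2) ^ 2 := by
  classical
  rw [sum_norm_pow_four_braket_conjState, Nat.card_eq_fintype_card, Fintype.card_subtype,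
    Finset.card_filter, Nat.cast_sum]
  refine Finset.sum_le_sum fun u _ => ?_
  split_ifs with hu
  · rcases (braket_eq_one_or_neg_one_iff hψ u).2 hu with h | h <;> norm_num [h]
  · simpa using (by positivity : 0 ≤ (braket ψ (pauliString u) ψ).re ^ 4)

theorem norm_sq_braket_conjState_le_one {ψ : QubitSpace n} (hψ : ‖ψ‖ = 1) {A : QubitOp n}
    (hA : A ∈ Matrix.unitaryGroup (Fin n → Fin 2) ℂ) : ‖braket (conjState ψ) A ψ‖ ^ 2 ≤ 1 := by
  have h := norm_braket_le hA (conjState ψ) ψ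
  rw [norm_conjState, hψ, one_mul] at h
  exact pow_le_one₀ (norm_nonneg _) h

theorem sum_norm_sq_braket_conjState {ψ : QubitSpace n} (hψ : ‖ψ‖ = 1) :
    ∑ u, ‖braket (conjState ψ) (pauliString u) ψ‖ ^ 2 = 2 ^ n := by
  rw [sum_norm_sq_braket, norm_conjState, hψ]
  simp

/-! ### Attainment of the maxima -/

theorem isGreatest_pauliOverlaps (ψ : QubitSpace n) :
    IsGreatest (pauliOverlaps ψ) (sSup (pauliOverlaps ψ)) := by
  rw [pauliOverlaps_eq_range]
  exact (Set.finite_range _).isCompact.isGreatest_sSup (Set.range_nonempty _)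

/-- The largest overlap with a Pauli string is at least the ratio of the fourth to the second
moment of the overlaps. -/
theorem card_eigenLabels_le_sSup {ψ : QubitSpace n} (hψ : ‖ψ‖ = 1) :
    (Nat.card (eigenLabels ψ) : ℝ) ≤ sSup (pauliOverlaps ψ) * 2 ^ n := by
  refine (card_eigenLabels_le_sum hψ).trans ?_
  rw [← sum_norm_sq_braket_conjState hψ, Finset.mul_sum]
  refine Finset.sum_le_sum fun u _ => ?_
  rw [sq (‖_‖ ^ 2)]
  refine mul_le_mul_of_nonneg_right ((isGreatest_pauliOverlaps ψ).2 ?_) (by positivity)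
  rw [pauliOverlaps_eq_range]
  exact ⟨u, rfl⟩

theorem sSup_pauliOverlaps_le_one {ψ : QubitSpace n} (hψ : ‖ψ‖ = 1) :
    sSup (pauliOverlaps ψ) ≤ 1 := by
  have h := (isGreatest_pauliOverlaps ψ).1
  rw [pauliOverlaps_eq_range] at h
  obtain ⟨u, hu⟩ := h
  rw [pauliOverlaps_eq_range, ← hu]
  exact norm_sq_braket_conjState_le_one hψ (pauliString_mem_unitaryGroup u)

theorem sSup_pauliOverlaps_pos {ψ : QubitSpace n} (hψ : ‖ψ‖ = 1) :
    0 < sSup (pauliOverlaps ψ) := by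
  have h1 : (0 : ℝ) < Nat.card (eigenLabels ψ) := Nat.cast_pos.2 Nat.card_pos
  exact pos_of_mul_pos_left (h1.trans_le (card_eigenLabels_le_sSup hψ)) (by positivity)

theorem isCompact_unitaryGroup (m : Type*) [Fintype m] [DecidableEq m] :
    IsCompact (Matrix.unitaryGroup m ℂ : Set (Matrix m m ℂ)) := by
  have hK : IsCompact (Set.univ.pi fun _ : m => Set.univ.pi fun _ : m =>
      Metric.closedBall (0 : ℂ) 1) :=
    isCompact_univ_pi fun _ => isCompact_univ_pi fun _ => isCompact_closedBall _ _
  refine IsCompact.of_isClosed_subset hK ?_ ?_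
  · have : (Matrix.unitaryGroup m ℂ : Set (Matrix m m ℂ)) = {A | A * star A = 1} := by
      ext A
      exact Matrix.mem_unitaryGroup_iff
    rw [this]
    exact isClosed_eq (by fun_prop) continuous_const
  · intro A hA i _ j _
    rw [mem_closedBall_zero_iff]
    exact entry_norm_bound_of_unitary hA i j

theorem isGreatest_localOverlaps (ψ : QubitSpace n) :
    IsGreatest (localOverlaps ψ) (sSup (localOverlaps ψ)) := by
  have h : localOverlaps ψ = (fun U => ‖braket (conjState ψ) (tensorOp U) ψ‖ ^ 2) ''
      (Set.univ.pi fun _ => (Matrix.unitaryGroup (Fin 2) ℂ : Set (Matrix (Fin 2) (Fin 2) ℂ))) := by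
    ext x
    constructor
    · rintro ⟨U, hU, rfl⟩
      exact ⟨U, fun i _ => hU i, rfl⟩
    · rintro ⟨U, hU, rfl⟩
      exact ⟨U, fun i => hU i trivial, rfl⟩
  have hc : Continuous fun U : Fin n → Matrix (Fin 2) (Fin 2) ℂ =>
      ‖braket (conjState ψ) (tensorOp U) ψ‖ ^ 2 := by
    simp only [braket_eq_sum, tensorOp_apply]
    fun_prop
  rw [h]
  refine ((isCompact_univ_pi fun _ => isCompact_unitaryGroup (Fin 2)).image hc).isGreatest_sSup
    (Set.Nonempty.image _ ⟨fun _ => 1, fun _ _ => one_mem _⟩)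

theorem sSup_localOverlaps_le_one {ψ : QubitSpace n} (hψ : ‖ψ‖ = 1) :
    sSup (localOverlaps ψ) ≤ 1 := by
  obtain ⟨U, hU, h⟩ := (isGreatest_localOverlaps ψ).1
  rw [h]
  exact norm_sq_braket_conjState_le_one hψ (tensorOp_mem_unitaryGroup hU)

theorem sSup_pauliOverlaps_le_sSup_localOverlaps (ψ : QubitSpace n) :
    sSup (pauliOverlaps ψ) ≤ sSup (localOverlaps ψ) := by
  refine (isGreatest_localOverlaps ψ).2 ?_
  have h := (isGreatest_pauliOverlaps ψ).1
  rw [pauliOverlaps_eq_range] at h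
  obtain ⟨u, hu⟩ := h
  rw [pauliOverlaps_eq_range, ← hu]
  exact ⟨_, fun i => kleinPauli_mem_unitaryGroup (u i), rfl⟩

/-! ### Stabilizer states -/

theorem list_prod_pauliString {ι : Type*} (S : ι → QubitOp n) (w : ι → Fin n → ZMod 2 × ZMod 2)
    (h : ∀ i, ∃ c : ℂ, c ≠ 0 ∧ S i = c • pauliString (w i)) (l : List ι) :
    ∃ c : ℂ, c ≠ 0 ∧ (l.map S).prod = c • pauliString (l.map w).sum := by
  induction l with
  | nil => exact ⟨1, one_ne_zero, by simp [pauliString_zero]⟩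
  | cons i l ih =>
    obtain ⟨c, hc, hS⟩ := h i
    obtain ⟨d, hd, hl⟩ := ih
    obtain ⟨e, he, hm⟩ := exists_pauliString_mul (w i) (l.map w).sum
    refine ⟨c * d * e, mul_ne_zero (mul_ne_zero hc hd) he, ?_⟩
    rw [List.map_cons, List.prod_cons, List.map_cons, List.sum_cons, hS, hl, smul_mul_smul_comm,
      hm, smul_smul]

theorem subsetProd_eq_smul_pauliString {S : Fin n → QubitOp n} {w : Fin n → Fin n → ZMod 2 × ZMod 2}
    (h : ∀ i, ∃ c : ℂ, c ≠ 0 ∧ S i = c • pauliString (w i)) (T : Finset (Fin n)) :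
    ∃ c : ℂ, c ≠ 0 ∧ subsetProd S T = c • pauliString (∑ i ∈ T, w i) := by
  have h' : ∀ i, ∃ c : ℂ, c ≠ 0 ∧ (if i ∈ T then S i else 1) =
      c • pauliString (if i ∈ T then w i else 0) := by
    intro i
    split_ifs
    · exact h i
    · exact ⟨1, one_ne_zero, by rw [pauliString_zero, one_smul]⟩
  obtain ⟨c, hc, hl⟩ := list_prod_pauliString _ _ h' (List.finRange n)
  refine ⟨c, hc, ?_⟩
  rw [subsetProd, List.ofFn_eq_map, hl, ← List.ofFn_eq_map, List.sum_ofFn]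
  simp

theorem exists_label {S : Fin n → QubitOp n} (h : ∀ j, S j ∈ pauliGroup n) :
    ∃ w : Fin n → Fin n → ZMod 2 × ZMod 2, ∀ i, ∃ c : ℂ, c ≠ 0 ∧ S i = c • pauliString (w i) := by
  choose c hc u hu using fun j => mem_pauliGroup_iff.1 (h j)
  exact ⟨u, fun i => ⟨c i, fun h0 => by simpa [h0] using norm_phase (hc i), hu i⟩⟩

/-- Over `ZMod 2`, coinciding subset sums give a vanishing sum over the symmetric difference of the
subsets, which expresses one generator by others. -/
theorem IsStabilizerGenerators.injective_sum {S : Fin n → QubitOp n} (hS : IsStabilizerGenerators S)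
    {w : Fin n → Fin n → ZMod 2 × ZMod 2} (h : ∀ i, ∃ c : ℂ, c ≠ 0 ∧ S i = c • pauliString (w i)) :
    Function.Injective fun T : Finset (Fin n) => ∑ i ∈ T, w i := by
  intro T T' hT
  by_contra hne
  have hsum : ∑ i ∈ symmDiff T T', w i = 0 := by
    have h1 : ∑ i ∈ symmDiff T T', w i = ∑ i ∈ T, w i + ∑ i ∈ T', w i := by
      rw [← Finset.sum_inter_add_sum_sdiff T T', ← Finset.sum_inter_add_sum_sdiff T' T,
        Finset.inter_comm T' T, add_add_add_comm, add_self_eq_zero, zero_add,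
        ← Finset.sum_union disjoint_sdiff_sdiff]
      rfl
    rw [h1]
    simp only at hT
    rw [hT, add_self_eq_zero]
  obtain ⟨j, hj⟩ : (symmDiff T T').Nonempty :=
    Finset.nonempty_iff_ne_empty.2 fun h0 => hne (symmDiff_eq_bot.1 h0)
  rw [← Finset.add_sum_erase _ _ hj] at hsum
  obtain ⟨c, hc, hSj⟩ := h j
  obtain ⟨d, hd, hprod⟩ := subsetProd_eq_smul_pauliString h ((symmDiff T T').erase j)
  refine hS.independent j ((symmDiff T T').erase j) (Finset.notMem_erase _ _) (c * d⁻¹) ?_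
  rw [hprod, hSj, smul_smul, mul_assoc, inv_mul_cancel₀ hd, mul_one, eq_of_add_eq_zero hsum]

theorem list_prod_mulVec {m : Type*} [Fintype m] [DecidableEq m] {l : List (Matrix m m ℂ)}
    {x : m → ℂ} (h : ∀ A ∈ l, A *ᵥ x = x) : l.prod *ᵥ x = x := by
  induction l with
  | nil => simp
  | cons A l ih =>
    rw [List.prod_cons, ← Matrix.mulVec_mulVec, ih fun B hB => h B (List.mem_cons_of_mem _ hB),
      h A List.mem_cons_self]

theorem IsStabilizerState.two_pow_le_card {φ : QubitSpace n} (hφ : IsStabilizerState φ) :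
    2 ^ n ≤ Nat.card (eigenLabels φ) := by
  obtain ⟨-, S, hS, hfix⟩ := hφ
  obtain ⟨w, hw⟩ := exists_label hS.mem_pauliGroup
  have hmem : ∀ T : Finset (Fin n), ∑ i ∈ T, w i ∈ eigenLabels φ := by
    intro T
    obtain ⟨c, hc, h⟩ := subsetProd_eq_smul_pauliString hw T
    refine ⟨c⁻¹, ?_⟩
    have h1 : subsetProd S T *ᵥ φ.ofLp = φ.ofLp := by
      refine list_prod_mulVec fun A hA => ?_
      obtain ⟨j, rfl⟩ := (List.mem_ofFn' _ _).1 hA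
      dsimp only
      split_ifs
      · exact hfix j
      · exact Matrix.one_mulVec _
    rw [h, Matrix.smul_mulVec] at h1
    rw [← inv_smul_smul₀ hc (pauliString _ *ᵥ φ.ofLp), h1]
  have := Nat.card_le_card_of_injective
    (fun T : Finset (Fin n) => (⟨_, hmem T⟩ : eigenLabels φ))
    fun T T' h => hS.injective_sum hw (Subtype.ext_iff.1 h)
  simpa [Nat.card_eq_fintype_card] using this

/-- For a stabilizer state every overlap with a Pauli string is `0` or `1`, since the second and the
fourth moment of the overlaps agree. -/
theorem IsStabilizerState.norm_braket_conjState {φ : QubitSpace n} (hφ : IsStabilizerState φ)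
    (u : Fin n → ZMod 2 × ZMod 2) :
    ‖braket (conjState φ) (pauliString u) φ‖ = ‖braket (conjState φ) (pauliString u) φ‖ ^ 2 := by
  set f : (Fin n → ZMod 2 × ZMod 2) → ℝ :=
    fun u => ‖braket (conjState φ) (pauliString u) φ‖ ^ 2 with hf
  have h0 : ∀ u, 0 ≤ f u - f u ^ 2 := fun u => by
    have h1 : f u ≤ 1 := norm_sq_braket_conjState_le_one hφ.1 (pauliString_mem_unitaryGroup u)
    have h2 : 0 ≤ f u := by positivity
    nlinarith
  have hsum : ∑ u, (f u - f u ^ 2) ≤ 0 := by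
    rw [Finset.sum_sub_distrib, sum_norm_sq_braket_conjState hφ.1, sub_nonpos]
    refine le_trans ?_ (card_eigenLabels_le_sum hφ.1)
    exact_mod_cast hφ.two_pow_le_card
  have h := (Finset.sum_eq_zero_iff_of_nonneg fun u _ => h0 u).1
    (le_antisymm hsum (Finset.sum_nonneg fun u _ => h0 u)) u (Finset.mem_univ u)
  have h3 : f u = f u ^ 2 := sub_eq_zero.1 h
  exact (pow_left_inj₀ (norm_nonneg _) (by positivity) two_ne_zero).1 h3

/-- The orthogonality relations of the Pauli strings expand the square of `⟨φ|ψ⟩` in the products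
of the overlaps of `φ` and `ψ`, and for a stabilizer state `φ` the former add up to `2 ^ n`. -/
theorem IsStabilizerState.norm_sq_inner_sq_le {φ : QubitSpace n} (hφ : IsStabilizerState φ)
    {ψ : QubitSpace n} (hψ : ‖ψ‖ = 1) : (‖inner ℂ φ ψ‖ ^ 2) ^ 2 ≤ sSup (pauliOverlaps ψ) := by
  have hM : ∀ u, ‖braket (conjState ψ) (pauliString u) ψ‖ ≤ √(sSup (pauliOverlaps ψ)) := by
    intro u
    refine Real.le_sqrt_of_sq_le ((isGreatest_pauliOverlaps ψ).2 ?_)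
    rw [pauliOverlaps_eq_range]
    exact ⟨u, rfl⟩
  have h := congr_arg norm
    (sum_star_braket_mul_braket (conjState ψ) ψ (conjState φ) φ)
  rw [inner_conjState, norm_mul, norm_mul, norm_pow, Complex.norm_ofNat] at h
  have h1 : 2 ^ n * ‖inner ℂ φ ψ‖ ^ 2 ≤ 2 ^ n * √(sSup (pauliOverlaps ψ)) := by
    rw [sq, ← h]
    refine (norm_sum_le _ _).trans ?_
    rw [← sum_norm_sq_braket_conjState hφ.1, Finset.sum_mul]
    refine Finset.sum_le_sum fun u _ => ?_
    rw [norm_mul, norm_star, ← hφ.norm_braket_conjState u]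
    exact mul_le_mul_of_nonneg_left (hM u) (norm_nonneg _)
  have h2 := le_of_mul_le_mul_left h1 (by positivity)
  exact (Real.le_sqrt (by positivity) (sSup_pauliOverlaps_pos hψ).le).1 h2

/-- The state `|x⟩` of the computational basis is stabilized by the operators `(-1) ^ x j Z j`. -/
theorem isStabilizerState_single (x : Fin n → Fin 2) :
    IsStabilizerState (EuclideanSpace.single x 1 : QubitSpace n) := by
  set e : Fin n → Fin n → ZMod 2 × ZMod 2 := fun j => Pi.single j (0, 1) with he
  set S : Fin n → QubitOp n :=
    fun j => (if x j = 0 then (1 : ℂ) else -1) • pauliString (e j) with hSdef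
  have hcne : ∀ j, (if x j = 0 then (1 : ℂ) else -1) ≠ 0 := fun j => by split_ifs <;> simp
  have hcc : ∀ j, (if x j = 0 then (1 : ℂ) else -1) * (if x j = 0 then (1 : ℂ) else -1) = 1 :=
    fun j => by split_ifs <;> simp
  have hlabel : ∀ j, ∃ c : ℂ, c ≠ 0 ∧ S j = c • pauliString (e j) := fun j => ⟨_, hcne j, rfl⟩
  have hcol : ∀ j s, pauliString (e j) s x =
      if s = x then (if x j = 0 then (1 : ℂ) else -1) else 0 := by
    intro j s
    have hz : ∀ i, kleinPauli (e j i) (s i) (x i) =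
        if s i = x i then (if i = j then (if x j = 0 then (1 : ℂ) else -1) else 1) else 0 := by
      intro i
      rcases eq_or_ne i j with rfl | hij
      · simp only [he, Pi.single_eq_same, kleinPauli_zero_one]
        generalize s i = a
        generalize x i = b
        fin_cases a <;> fin_cases b <;> simp
      · simp only [he, Pi.single_eq_of_ne hij, kleinPauli_zero, Matrix.one_apply, if_neg hij]
    simp only [pauliString, tensorOp_apply, hz, Finset.prod_ite_zero]
    simp [funext_iff]
  refine ⟨by simp, S, ⟨?_, ?_, ?_, ?_⟩, ?_⟩
  · intro j
    refine mem_pauliGroup_iff.2 ⟨_, ?_, e j, rfl⟩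
    split_ifs <;> simp
  · intro i j
    simp only [hSdef, smul_mul_smul_comm, pauliString, tensorOp_mul]
    rw [mul_comm]
    congr 2
    funext k
    rcases eq_or_ne k i with rfl | hi
    · rcases eq_or_ne k j with rfl | hj
      · rfl
      · simp [he, Pi.single_eq_of_ne hj, kleinPauli_zero]
    · simp [he, Pi.single_eq_of_ne hi, kleinPauli_zero]
  · intro j
    simp only [hSdef, smul_mul_smul_comm, hcc, pauliString_mul_self, one_smul]
  · intro j T hj c hc
    obtain ⟨d, hd, hT⟩ := subsetProd_eq_smul_pauliString hlabel T
    rw [hT, smul_smul] at hc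
    have h1 : pauliString (e j) = ((if x j = 0 then (1 : ℂ) else -1) * (c * d)) •
        pauliString (∑ i ∈ T, e i) := by
      rw [← smul_smul, ← hc, hSdef, smul_smul, hcc, one_smul]
    -- compare the labels on qubit `j`, where the generators with index in `T` act trivially
    have h2 := congr_fun (eq_of_pauliString_eq_smul h1) j
    rw [Finset.sum_apply, Finset.sum_eq_zero fun i hi => Pi.single_eq_of_ne
      (fun h => hj (by rwa [h])) _] at h2
    simp [he] at h2
  · intro j
    funext s
    simp only [hSdef, PiLp.ofLp_single, Matrix.mulVec_single_one,
      Matrix.smul_apply, Matrix.col_apply, hcol, smul_eq_mul, mul_ite, hcc, mul_zero, Pi.single_apply]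

theorem isCompact_isStabilizerState : IsCompact {φ : QubitSpace n | IsStabilizerState φ} := by
  have h : {φ : QubitSpace n | IsStabilizerState φ} =
      ⋃ S ∈ {S : Fin n → QubitOp n | IsStabilizerGenerators S},
        Metric.sphere 0 1 ∩ {φ | ∀ j, S j *ᵥ φ.ofLp = φ.ofLp} := by
    ext φ
    simp only [IsStabilizerState, Set.mem_ofPred_eq, Set.mem_iUnion, Set.mem_inter_iff,
      mem_sphere_zero_iff_norm, exists_prop]
    tauto
  have hfin : {S : Fin n → QubitOp n | IsStabilizerGenerators S}.Finite :=
    (Set.Finite.pi' fun _ => finite_pauliGroup).subset fun S hS => hS.mem_pauliGroup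
  rw [h]
  refine hfin.isCompact_biUnion fun S _ => (isCompact_sphere 0 1).inter_right ?_
  simp only [Set.ofPred_forall]
  refine isClosed_iInter fun j => isClosed_eq ?_ ?_ <;> fun_prop

theorem isGreatest_stabilizerOverlaps (ψ : QubitSpace n) :
    IsGreatest (stabilizerOverlaps ψ) (stabilizerFidelity ψ) := by
  have h : stabilizerOverlaps ψ =
      (fun φ => ‖inner ℂ φ ψ‖ ^ 2) '' {φ : QubitSpace n | IsStabilizerState φ} := by
    ext x
    constructor
    · rintro ⟨φ, hφ, rfl⟩
      exact ⟨φ, hφ, rfl⟩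
    · rintro ⟨φ, hφ, rfl⟩
      exact ⟨φ, hφ, rfl⟩
  rw [stabilizerFidelity, h]
  exact (isCompact_isStabilizerState.image (by fun_prop)).isGreatest_sSup
    (Set.Nonempty.image _ ⟨_, isStabilizerState_single 0⟩)

theorem stabilizerFidelity_pos {ψ : QubitSpace n} (hψ : ‖ψ‖ = 1) : 0 < stabilizerFidelity ψ := by
  obtain ⟨x, hx⟩ : ∃ x, ψ x ≠ 0 := by
    by_contra! h
    have : ψ = 0 := by
      ext x
      exact h x
    simp [this] at hψ
  have h := (isGreatest_stabilizerOverlaps ψ).2 ⟨_, isStabilizerState_single x, rfl⟩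
  refine lt_of_lt_of_le ?_ h
  rw [EuclideanSpace.inner_single_left, map_one, one_mul]
  exact pow_pos (norm_pos_iff.2 hx) 2

theorem stabilizerFidelity_sq_le {ψ : QubitSpace n} (hψ : ‖ψ‖ = 1) :
    stabilizerFidelity ψ ^ 2 ≤ sSup (pauliOverlaps ψ) := by
  obtain ⟨φ, hφ, h⟩ := (isGreatest_stabilizerOverlaps ψ).1
  rw [h]
  exact hφ.norm_sq_inner_sq_le hψ

theorem IsStabilizerState.stabilizerFidelity_eq_one {ψ : QubitSpace n} (hψ : IsStabilizerState ψ) :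
    stabilizerFidelity ψ = 1 := by
  refine le_antisymm ?_ ?_
  · obtain ⟨φ, hφ, h⟩ := (isGreatest_stabilizerOverlaps ψ).1
    rw [h]
    refine pow_le_one₀ (norm_nonneg _) ((norm_inner_le_norm _ _).trans ?_)
    rw [hφ.1, hψ.1, one_mul]
  · refine (isGreatest_stabilizerOverlaps ψ).2 ⟨ψ, hψ, ?_⟩
    simp [inner_self_eq_norm_sq_to_K, hψ.1]

end ChiralityMagic

theorem mainTheorem1 (n : ℕ) (ψ : QubitSpace n) (hψ : ‖ψ‖ = 1) :
    -- the maxima in the definitions of `C`, `C_P` and `F` are attained and positive,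
    -- and the number of Pauli strings with a definite value is `2 ^ k` with `ν = n - k`
    ((IsGreatest (localOverlaps ψ) (sSup (localOverlaps ψ)) ∧ 0 < sSup (localOverlaps ψ)) ∧
      (IsGreatest (pauliOverlaps ψ) (sSup (pauliOverlaps ψ)) ∧ 0 < sSup (pauliOverlaps ψ)) ∧
      (IsGreatest (stabilizerOverlaps ψ) (stabilizerFidelity ψ) ∧ 0 < stabilizerFidelity ψ) ∧
      ∃ k : ℕ, k ≤ n ∧ (definitePauliStrings ψ).ncard = 2 ^ k ∧
        stabilizerNullity ψ = (n : ℤ) - (k : ℤ)) ∧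
    -- the two chains of inequalities
    (chiralLogDistance ψ ≤ pauliChiralLogDistance ψ ∧
      pauliChiralLogDistance ψ ≤ (stabilizerNullity ψ : ℝ)) ∧
    (chiralLogDistance ψ ≤ pauliChiralLogDistance ψ ∧
      pauliChiralLogDistance ψ ≤ -2 * Real.logb 2 (stabilizerFidelity ψ)) ∧
    -- saturation on pure stabilizer states
    (IsStabilizerState ψ →
      chiralLogDistance ψ = 0 ∧ pauliChiralLogDistance ψ = 0 ∧ stabilizerNullity ψ = 0 ∧
        -2 * Real.logb 2 (stabilizerFidelity ψ) = 0) := by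
  have hP := sSup_pauliOverlaps_pos hψ
  have hPL := sSup_pauliOverlaps_le_sSup_localOverlaps ψ
  have hL := hP.trans_le hPL
  have hF := stabilizerFidelity_pos hψ
  obtain ⟨k, hk⟩ := exists_card_eigenLabels ψ
  have hle : (2 : ℝ) ^ k ≤ sSup (pauliOverlaps ψ) * 2 ^ n := by
    have h := card_eigenLabels_le_sSup hψ
    rw [hk] at h
    exact_mod_cast h
  have hkn : k ≤ n := by
    have h : (2 : ℝ) ^ k ≤ 2 ^ n :=
      hle.trans (mul_le_of_le_one_left (by positivity) (sSup_pauliOverlaps_le_one hψ))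
    exact (pow_le_pow_iff_right₀ one_lt_two).1 h
  have hcard : (definitePauliStrings ψ).ncard = 2 ^ k := by
    rw [ncard_definitePauliStrings hψ, hk]
  have hν : stabilizerNullity ψ = (n : ℤ) - (k : ℤ) := by
    rw [stabilizerNullity, hcard, Nat.log_pow one_lt_two]
  have hC : chiralLogDistance ψ ≤ pauliChiralLogDistance ψ :=
    neg_le_neg (Real.logb_le_logb_of_le one_lt_two hP hPL)
  have hCP : pauliChiralLogDistance ψ ≤ (stabilizerNullity ψ : ℝ) := by
    have h := Real.logb_le_logb_of_le one_lt_two (by positivity) hle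
    rw [Real.logb_mul hP.ne' (by positivity), Real.logb_pow, Real.logb_pow,
      Real.logb_self_eq_one one_lt_two] at h
    rw [hν, pauliChiralLogDistance]
    push_cast
    linarith
  have hCF : pauliChiralLogDistance ψ ≤ -2 * Real.logb 2 (stabilizerFidelity ψ) := by
    have h := Real.logb_le_logb_of_le one_lt_two (by positivity) (stabilizerFidelity_sq_le hψ)
    rw [Real.logb_pow] at h
    rw [pauliChiralLogDistance]
    push_cast at h
    linarith
  refine ⟨⟨⟨isGreatest_localOverlaps ψ, hL⟩, ⟨isGreatest_pauliOverlaps ψ, hP⟩,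
    ⟨isGreatest_stabilizerOverlaps ψ, hF⟩, k, hkn, hcard, hν⟩, ⟨hC, hCP⟩, ⟨hC, hCF⟩, fun hs => ?_⟩
  have hk' : k = n := by
    have h := hs.two_pow_le_card
    rw [hk] at h
    exact le_antisymm hkn ((Nat.pow_le_pow_iff_right one_lt_two).1 h)
  have hν0 : stabilizerNullity ψ = 0 := by rw [hν, hk', sub_self]
  have hC0 : 0 ≤ chiralLogDistance ψ :=
    neg_nonneg.2 (Real.logb_nonpos one_lt_two hL.le (sSup_localOverlaps_le_one hψ))
  rw [hν0, Int.cast_zero] at hCP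
  exact ⟨le_antisymm (hC.trans hCP) hC0, le_antisymm hCP (hC0.trans hC), hν0, by
    rw [hs.stabilizerFidelity_eq_one, Real.logb_one, mul_zero]⟩
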